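/- Let $k$ be a field, $L/k$ a finite Galois extension with Galois group $G=\mathrm{Gal}(L/k)$, and let $\alpha\colon G\times G\to L^*$ be a 2-cocycle (for the Galois action of $G$ on $L^*$) whose class in $H^2(G,L^*)$ has order $m$. Suppose that $\mathrm{char}\,k=0$, or that $\mathrm{char}\,k=p>0$ and $p\nmid m$. For a finite Galois extension $K/k$ with group $N=\mathrm{Gal}(K/k)$ and a 2-cocycle $\beta\colon N\times N\to K^*$, let $K^{\beta}_tN$ denote the crossed product algebra: the central simple $k$-algebra with $K$-basis $\{U_g\}_{g\in N}$ and multiplication $(xU_g)(yU_h)=x\,g(y)\,\beta(g,h)\,U_{gh}$ for $x,y\in K$ and $g,h\in N$. Then there exist a finite Galois extension $K/k$ containing $L$ and, with $N=\mathrm{Gal}(K/k)$, a 2-cocycle $\beta\colon N\times N\to K^*$ all of whose values are $m$-th roots of unity (so $\beta$ is finite, that is, all its values are roots of unity), such that the crossed product algebras $L^{\alpha}_tG$ and $K^{\beta}_tN$ are Brauer equivalent over $k$. -/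

import Mathlib

universe u v

section Cohomology

variable (G : Type u) (M : Type v) [Group G] [CommGroup M] [MulDistribMulAction G M]

/-- The group `Z²(G, M)` of 2-cocycles of `G` with values in the (multiplicatively written)
`G`-module `M`, under pointwise multiplication. -/
def TwoCocycles : Subgroup (G × G → M) where
  carrier := {f | groupCohomology.IsMulCocycle₂ f}
  one_mem' := fun g h j => by simp
  mul_mem' := fun {a b} ha hb g h j => by
    have h1 := ha g h j
    have h2 := hb g h j
    simp only [Pi.mul_apply, smul_mul']
    rw [mul_mul_mul_comm, h1, h2, mul_mul_mul_comm]
  inv_mem' := fun {a} ha g h j => by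
    have h1 := ha g h j
    simp only [Pi.inv_apply, smul_inv']
    rw [← mul_inv, h1, mul_inv]

/-- The group `B²(G, M)` of 2-coboundaries of `G` with values in `M`. -/
def TwoCoboundaries : Subgroup (G × G → M) where
  carrier := {f | groupCohomology.IsMulCoboundary₂ f}
  one_mem' := ⟨1, fun g h => by simp⟩
  mul_mem' := by
    rintro a b ⟨x, hx⟩ ⟨y, hy⟩
    refine ⟨x * y, fun g h => ?_⟩
    simp only [Pi.mul_apply, smul_mul', ← hx, ← hy]
    rw [mul_div_mul_comm, mul_mul_mul_comm]
  inv_mem' := by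
    rintro a ⟨x, hx⟩
    refine ⟨x⁻¹, fun g h => ?_⟩
    simp only [Pi.inv_apply, smul_inv', ← hx, mul_inv, inv_div_inv, inv_div]

/-- The second cohomology group `H²(G, M) = Z²(G, M) / B²(G, M)`. -/
abbrev SecondCohomology : Type _ :=
  TwoCocycles G M ⧸ (TwoCoboundaries G M).subgroupOf (TwoCocycles G M)

variable {G M}

/-- The cohomology class of a 2-cocycle. -/
def cohomologyClass (α : TwoCocycles G M) : SecondCohomology G M :=
  QuotientGroup.mk α

/-- A cocycle is finite if all its values are roots of unity (elements of finite order). -/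
def IsFiniteCocycle (α : TwoCocycles G M) : Prop :=
  ∀ g h : G, IsOfFinOrder (α.1 (g, h))

end Cohomology

section CrossedProduct

variable {k : Type u} {L : Type v} [Field k] [Field L] [Algebra k L]

/-- The crossed product algebra of the extension `L / k` with group `G = Gal(L/k)` and a 2-cocycle
`α ∈ Z²(G, Lˣ)`. As an `L`-vector space it has the basis `U_g` (`g ∈ G`), where `x U_g` is
`Finsupp.single g x`. -/
def CrossedProduct (_α : TwoCocycles Gal(L/k) Lˣ) : Type v := Gal(L/k) →₀ L

namespace CrossedProduct

variable (α : TwoCocycles Gal(L/k) Lˣ)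

noncomputable instance : AddCommGroup (CrossedProduct α) :=
  inferInstanceAs (AddCommGroup (Gal(L/k) →₀ L))

noncomputable instance : Module L (CrossedProduct α) :=
  inferInstanceAs (Module L (Gal(L/k) →₀ L))

noncomputable instance : Module k (CrossedProduct α) :=
  inferInstanceAs (Module k (Gal(L/k) →₀ L))

/-- The element `x U_g`. -/
noncomputable def of (g : Gal(L/k)) (x : L) : CrossedProduct α := Finsupp.single g x

/-- The coefficient of `U_g`. -/
def coeff (a : CrossedProduct α) (g : Gal(L/k)) : L := (show Gal(L/k) →₀ L from a) g

/-- The bilinear extension of `(x U_g) (y U_h) = x g(y) α(g, h) U_{gh}`. -/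
noncomputable def mulFun (a b : Gal(L/k) →₀ L) : Gal(L/k) →₀ L :=
  a.sum fun g x => b.sum fun h y => Finsupp.single (g * h) (x * g y * (α.1 (g, h) : L))

noncomputable instance : Mul (CrossedProduct α) where
  mul := mulFun α

/-- The unit is `α(1, 1)⁻¹ U_1` (cocycles need not be normalized). -/
noncomputable instance : One (CrossedProduct α) where
  one := of α 1 ((α.1 (1, 1))⁻¹ : Lˣ)

theorem of_add (g : Gal(L/k)) (x y : L) : of α g (x + y) = of α g x + of α g y :=
  Finsupp.single_add g x y

theorem of_zero (g : Gal(L/k)) : of α g 0 = 0 := Finsupp.single_zero g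

theorem smul_of (c : k) (g : Gal(L/k)) (x : L) : c • of α g x = of α g (c • x) :=
  Finsupp.smul_single c g x

theorem coeff_add (a b : CrossedProduct α) (g : Gal(L/k)) :
    coeff α (a + b) g = coeff α a g + coeff α b g := rfl

theorem coeff_sub (a b : CrossedProduct α) (g : Gal(L/k)) :
    coeff α (a - b) g = coeff α a g - coeff α b g := rfl

theorem coeff_zero (g : Gal(L/k)) : coeff α 0 g = 0 := rfl

theorem coeff_of_same (g : Gal(L/k)) (x : L) : coeff α (of α g x) g = x :=
  Finsupp.single_eq_same

theorem coeff_of_ne {g h : Gal(L/k)} (hgh : h ≠ g) (x : L) : coeff α (of α g x) h = 0 :=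
  Finsupp.single_eq_of_ne hgh

theorem ext_coeff {a b : CrossedProduct α} (h : ∀ g, coeff α a g = coeff α b g) : a = b :=
  Finsupp.ext h

theorem induction_of {p : CrossedProduct α → Prop} (a : CrossedProduct α) (h0 : p 0)
    (hadd : ∀ a b, p a → p b → p (a + b)) (hof : ∀ g x, p (of α g x)) : p a :=
  Finsupp.induction_linear (motive := p) a h0 hadd hof

theorem add_mulFun (a b c : Gal(L/k) →₀ L) : mulFun α (a + b) c = mulFun α a c + mulFun α b c := by
  refine Finsupp.sum_add_index' (fun g => ?_) (fun g x y => ?_)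
  · simp
  · rw [← Finsupp.sum_add]
    exact Finsupp.sum_congr fun h _ => by rw [← Finsupp.single_add]; ring_nf

theorem mulFun_add (a b c : Gal(L/k) →₀ L) : mulFun α a (b + c) = mulFun α a b + mulFun α a c := by
  rw [mulFun, mulFun, mulFun, ← Finsupp.sum_add]
  refine Finsupp.sum_congr fun g _ => Finsupp.sum_add_index' (fun h => ?_) (fun h x y => ?_)
  · simp
  · rw [← Finsupp.single_add, map_add]; ring_nf

theorem mulFun_zero (a : Gal(L/k) →₀ L) : mulFun α a 0 = 0 := by
  simp [mulFun]

theorem zero_mulFun (a : Gal(L/k) →₀ L) : mulFun α 0 a = 0 := by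
  simp [mulFun]

theorem mulFun_single_single (g h : Gal(L/k)) (x y : L) :
    mulFun α (Finsupp.single g x) (Finsupp.single h y) =
      Finsupp.single (g * h) (x * g y * (α.1 (g, h) : L)) := by
  refine (Finsupp.sum_single_index ?_).trans (Finsupp.sum_single_index ?_) <;> simp

theorem add_mul_aux (a b c : CrossedProduct α) : (a + b) * c = a * c + b * c :=
  add_mulFun α a b c

theorem mul_add_aux (a b c : CrossedProduct α) : a * (b + c) = a * b + a * c :=
  mulFun_add α a b c

theorem zero_mul_aux (a : CrossedProduct α) : 0 * a = 0 := zero_mulFun α a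

theorem mul_zero_aux (a : CrossedProduct α) : a * 0 = 0 := mulFun_zero α a

/-- The defining multiplication rule of the crossed product. -/
theorem of_mul_of (g h : Gal(L/k)) (x y : L) :
    of α g x * of α h y = of α (g * h) (x * g y * (α.1 (g, h) : L)) :=
  mulFun_single_single α g h x y

theorem cocycle_apply (g h j : Gal(L/k)) :
    (α.1 (g * h, j) : L) * (α.1 (g, h) : L) = g (α.1 (h, j) : L) * (α.1 (g, h * j) : L) := by
  have := congrArg (Units.val) (α.2 g h j)
  simpa using this

theorem cocycle_one_left (g : Gal(L/k)) : α.1 (1, g) = α.1 (1, 1) :=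
  groupCohomology.map_one_fst_of_isMulCocycle₂ α.2 g

theorem cocycle_one_right (g : Gal(L/k)) : (α.1 (g, 1) : L) = g (α.1 (1, 1) : L) := by
  simpa using congrArg Units.val (groupCohomology.map_one_snd_of_isMulCocycle₂ α.2 g)

theorem one_def : (1 : CrossedProduct α) = of α 1 ((α.1 (1, 1))⁻¹ : Lˣ) := rfl

noncomputable instance : Ring (CrossedProduct α) where
  __ := (inferInstance : AddCommGroup (CrossedProduct α))
  left_distrib := mul_add_aux α
  right_distrib := add_mul_aux α
  zero_mul := zero_mul_aux α
  mul_zero := mul_zero_aux α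
  mul_assoc a b c := by
    induction a using induction_of α with
    | h0 => simp only [zero_mul_aux]
    | hadd a a' ha ha' => simp only [add_mul_aux, ha, ha']
    | hof g x =>
      induction b using induction_of α with
      | h0 => simp only [zero_mul_aux, mul_zero_aux]
      | hadd b b' hb hb' => simp only [add_mul_aux, mul_add_aux, hb, hb']
      | hof h y =>
        induction c using induction_of α with
        | h0 => simp only [mul_zero_aux]
        | hadd c c' hc hc' => simp only [mul_add_aux, hc, hc']
        | hof j z =>
          simp only [of_mul_of, mul_assoc, map_mul, AlgEquiv.mul_apply]
          rw [← cocycle_apply]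
          ring_nf
  one_mul a := by
    induction a using induction_of α with
    | h0 => simp only [mul_zero_aux]
    | hadd a b ha hb => simp only [mul_add_aux, ha, hb]
    | hof g x =>
      rw [one_def, of_mul_of, cocycle_one_left α g, one_mul, AlgEquiv.one_apply, mul_right_comm]
      simp
  mul_one a := by
    induction a using induction_of α with
    | h0 => simp only [zero_mul_aux]
    | hadd a b ha hb => simp only [add_mul_aux, ha, hb]
    | hof g x =>
      rw [one_def, of_mul_of, cocycle_one_right, mul_one, mul_assoc, ← map_mul]
      simp

theorem smul_mul_aux (c : k) (a b : CrossedProduct α) : (c • a) * b = c • (a * b) := by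
  induction a using induction_of α with
  | h0 => simp
  | hadd a a' ha ha' => simp only [smul_add, add_mul, ha, ha']
  | hof g x =>
    induction b using induction_of α with
    | h0 => simp
    | hadd b b' hb hb' => simp only [mul_add, smul_add, hb, hb']
    | hof h y => simp only [smul_of, of_mul_of, smul_mul_assoc]

theorem mul_smul_aux (c : k) (a b : CrossedProduct α) : a * (c • b) = c • (a * b) := by
  induction a using induction_of α with
  | h0 => simp
  | hadd a a' ha ha' => simp only [smul_add, add_mul, ha, ha']
  | hof g x =>
    induction b using induction_of α with
    | h0 => simp
    | hadd b b' hb hb' => simp only [mul_add, smul_add, hb, hb']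
    | hof h y => simp only [smul_of, of_mul_of, map_smul, smul_mul_assoc, mul_smul_comm]

noncomputable instance : Algebra k (CrossedProduct α) :=
  Algebra.ofModule (smul_mul_aux α) (mul_smul_aux α)

/-- The copy of the element `x ∈ L` in the crossed product, that is `x · 1`. -/
noncomputable def scalar (x : L) : CrossedProduct α := of α 1 (x * ((α.1 (1, 1))⁻¹ : Lˣ))

theorem scalar_mul_of (x y : L) (g : Gal(L/k)) : scalar α x * of α g y = of α g (x * y) := by
  rw [scalar, of_mul_of, cocycle_one_left α g, one_mul, AlgEquiv.one_apply]
  congr 1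
  rw [mul_right_comm, mul_assoc x]
  simp

theorem of_mul_scalar (x y : L) (g : Gal(L/k)) : of α g y * scalar α x = of α g (y * g x) := by
  rw [scalar, of_mul_of, cocycle_one_right, mul_one, mul_assoc, ← map_mul]
  simp

theorem coeff_scalar_mul (x : L) (a : CrossedProduct α) (g : Gal(L/k)) :
    coeff α (scalar α x * a) g = x * coeff α a g := by
  induction a using induction_of α with
  | h0 => simp [coeff_zero]
  | hadd a b ha hb => rw [mul_add, coeff_add, coeff_add, ha, hb, mul_add]
  | hof h y =>
    rw [scalar_mul_of]
    by_cases hgh : g = h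
    · subst hgh; simp only [coeff_of_same]
    · simp only [coeff_of_ne α hgh, mul_zero]

theorem coeff_mul_scalar (x : L) (a : CrossedProduct α) (g : Gal(L/k)) :
    coeff α (a * scalar α x) g = coeff α a g * g x := by
  induction a using induction_of α with
  | h0 => simp [coeff_zero]
  | hadd a b ha hb => rw [add_mul, coeff_add, coeff_add, ha, hb, add_mul]
  | hof h y =>
    rw [of_mul_scalar]
    by_cases hgh : g = h
    · subst hgh; simp only [coeff_of_same]
    · simp only [coeff_of_ne α hgh, zero_mul]

theorem of_inv_mul_of (g : Gal(L/k)) (x : L) (hx : x ≠ 0) :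
    ∃ b : CrossedProduct α, b * of α g x = 1 := by
  refine ⟨of α g⁻¹ (((α.1 (1, 1))⁻¹ : Lˣ) * (g⁻¹ x)⁻¹ * ((α.1 (g⁻¹, g))⁻¹ : Lˣ)), ?_⟩
  rw [of_mul_of, one_def, inv_mul_cancel]
  congr 1
  have : g⁻¹ x ≠ 0 := by simpa using hx
  simp only [Units.val_inv_eq_inv_val]
  field_simp

instance : Nontrivial (CrossedProduct α) :=
  inferInstanceAs (Nontrivial (Gal(L/k) →₀ L))

instance [FiniteDimensional k L] : FiniteDimensional k (CrossedProduct α) :=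
  inferInstanceAs (FiniteDimensional k (Gal(L/k) →₀ L))

theorem mem_of_ne_zero (I : TwoSidedIdeal (CrossedProduct α)) (n : ℕ) :
    ∀ a : CrossedProduct α, a ∈ I → a ≠ 0 →
      (show Gal(L/k) →₀ L from a).support.card ≤ n → (1 : CrossedProduct α) ∈ I := by
  induction n with
  | zero =>
    intro a _ ha0 hc
    refine absurd ?_ ha0
    exact Finsupp.support_eq_empty.1 (Finset.card_eq_zero.1 (Nat.le_zero.1 hc))
  | succ n ih =>
    intro a ha ha0 hc
    obtain ⟨h, hh⟩ : ∃ h, coeff α a h ≠ 0 := by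
      by_contra hcon
      push Not at hcon
      exact ha0 (ext_coeff α hcon)
    by_cases hone : ∀ g, g ≠ h → coeff α a g = 0
    · have hah : a = of α h (coeff α a h) := by
        refine ext_coeff α fun g => ?_
        by_cases hg : g = h
        · subst hg; rw [coeff_of_same]
        · rw [hone g hg, coeff_of_ne α hg]
      obtain ⟨b, hb⟩ := of_inv_mul_of α h _ hh
      rw [← hb, ← hah]
      exact I.mul_mem_left _ _ ha
    · push Not at hone
      obtain ⟨g, hgh, hg⟩ := hone
      obtain ⟨x, hx⟩ : ∃ x, g x ≠ h x := by
        by_contra hcon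
        push Not at hcon
        exact hgh (AlgEquiv.ext hcon)
      have hco : ∀ s, coeff α (a * scalar α x - scalar α (h x) * a) s
          = coeff α a s * (s x - h x) := fun s => by
        rw [coeff_sub, coeff_mul_scalar, coeff_scalar_mul]; ring
      refine ih (a * scalar α x - scalar α (h x) * a)
        (I.sub_mem (I.mul_mem_right _ _ ha) (I.mul_mem_left _ _ ha)) (fun h0 => ?_) ?_
      · have := hco g
        rw [h0, coeff_zero] at this
        exact mul_ne_zero hg (sub_ne_zero.2 hx) this.symm
      · refine Nat.le_of_lt_succ (lt_of_lt_of_le (Finset.card_lt_card ?_) hc)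
        refine (Finset.ssubset_iff_of_subset fun s hs => ?_).2 ⟨h, ?_, ?_⟩
        · have hs' : coeff α (a * scalar α x - scalar α (h x) * a) s ≠ 0 :=
            Finsupp.mem_support_iff.1 hs
          rw [hco] at hs'
          exact Finsupp.mem_support_iff.2 (left_ne_zero_of_mul hs')
        · exact Finsupp.mem_support_iff.2 hh
        · refine Finsupp.notMem_support_iff.2 ((hco h).trans ?_)
          rw [sub_self, mul_zero]

instance : IsSimpleRing (CrossedProduct α) :=
  IsSimpleRing.of_eq_bot_or_eq_top fun I => by
    by_cases hI : I = ⊥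
    · exact Or.inl hI
    · right
      obtain ⟨a, ha, ha0⟩ : ∃ a ∈ I, a ≠ 0 := by
        by_contra hcon
        push Not at hcon
        refine hI (le_bot_iff.1 fun a ha => ?_)
        rw [hcon a ha]
        exact TwoSidedIdeal.zero_mem _
      exact I.one_mem_iff.1 (mem_of_ne_zero α I _ a ha ha0 le_rfl)

instance [IsGalois k L] : Algebra.IsCentral k (CrossedProduct α) where
  out := fun z hz => by
    rw [Subalgebra.mem_center_iff] at hz
    have hz1 : ∀ g, g ≠ 1 → coeff α z g = 0 := by
      intro g hg
      obtain ⟨x, hx⟩ : ∃ x, g x ≠ x := by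
        by_contra hcon
        push Not at hcon
        exact hg (AlgEquiv.ext hcon)
      have := congrArg (fun a => coeff α a g) (hz (scalar α x))
      simp only [coeff_scalar_mul, coeff_mul_scalar] at this
      by_contra h0
      rw [mul_comm] at this
      exact hx (mul_left_cancel₀ h0 this).symm
    obtain ⟨y, hy⟩ : ∃ y, z = scalar α y := by
      refine ⟨coeff α z 1 * (α.1 (1, 1) : L), ext_coeff α fun g => ?_⟩
      by_cases hg : g = 1
      · subst hg
        rw [scalar, coeff_of_same]
        simp
      · rw [hz1 g hg, scalar, coeff_of_ne α hg]
    subst hy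
    have hfix : ∀ g : Gal(L/k), g y = y := by
      intro g
      have := congrArg (fun a => coeff α a g) (hz (of α g 1))
      simpa only [scalar_mul_of, of_mul_scalar, coeff_of_same, one_mul, mul_one] using this
    obtain ⟨c, rfl⟩ := (InfiniteGalois.mem_range_algebraMap_iff_fixed y).2 hfix
    refine Algebra.mem_bot.2 ⟨c, ?_⟩
    rw [Algebra.algebraMap_eq_smul_one, one_def, smul_of, scalar, Algebra.smul_def]

/-- The crossed product of a finite Galois extension, as a central simple algebra. -/
noncomputable def csa [FiniteDimensional k L] [IsGalois k L] : CSA.{u, v} k where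
  toAlgCat := AlgCat.of k (CrossedProduct α)
  isCentral := inferInstanceAs (Algebra.IsCentral k (CrossedProduct α))
  isSimple := inferInstanceAs (IsSimpleRing (CrossedProduct α))
  fin_dim := inferInstanceAs (FiniteDimensional k (CrossedProduct α))

end CrossedProduct

end CrossedProduct

/-! ### Torsion in second cohomology. -/

section Cohomology

variable {G : Type u} {M : Type v} [Group G] [CommGroup M] [MulDistribMulAction G M]

/-! Since the class of `α` has order `m`, `α ^ m` is the coboundary of some `c : G → Lˣ`. If each `c
g` had an `m`-th root `d g` in `L`, dividing `α` by the coboundary of `d` would give a cohomologous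
cocycle killed by `m`. The roots need not lie in `L`, so they are adjoined: as `m` is invertible in
`k`, they are separable, and some finite Galois `K/k` containing `L` holds them all
(`exists_isGalois_forall_exists_pow_eq`). Over `K`, correct the inflation of `α` by the coboundary
of `e = d⁻¹`, with `d` pulled back along restriction; the result `β` satisfies `β ^ m = 1`.

It remains to see that passing from `α` to `β` keeps the Brauer class
(`isBrauerEquivalent_csa_of_inflation`). With `A` the crossed product of `α` and `r = [K : L]`, the
crossed product of `β` acts on the free right `A`-module `K ⊗[L] A` of rank `r`, hence maps to `r ×
r` matrices over `A`. This map is injective because its source is simple, and bijective because both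
sides have dimension `[K : k] ^ 2 = r ^ 2 * [L : k] ^ 2`. -/

/-- Every 2-coboundary is a 2-cocycle. -/
theorem groupCohomology.isMulCocycle₂_of_isMulCoboundary₂ {f : G × G → M}
    (hf : groupCohomology.IsMulCoboundary₂ f) : groupCohomology.IsMulCocycle₂ f := by
  obtain ⟨x, hx⟩ := hf
  intro g h j
  simp only [← hx, smul_mul', smul_smul, mul_assoc, div_eq_mul_inv, smul_inv']
  rw [mul_left_comm (x (g * h)), mul_inv_cancel_left, mul_left_comm (g • x h),
    inv_mul_cancel_left, mul_left_comm _ (g • x h), mul_left_comm _ (g • x h)]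

theorem TwoCocycles.pow_cohomologyClass_eq_one_iff (α : TwoCocycles G M) (m : ℕ) :
    cohomologyClass α ^ m = 1 ↔ groupCohomology.IsMulCoboundary₂ (α.1 ^ m) := by
  rw [cohomologyClass, ← QuotientGroup.mk_pow, QuotientGroup.eq_one_iff]
  rfl

/-- The second cohomology of a finite group is annihilated by the order of the group. -/
theorem TwoCocycles.cohomologyClass_pow_card [Finite G] (α : TwoCocycles G M) :
    cohomologyClass α ^ Nat.card G = 1 := by
  have := Fintype.ofFinite G
  rw [TwoCocycles.pow_cohomologyClass_eq_one_iff]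
  -- Multiply the cocycle identity over its last argument `j`; the translation `j ↦ h * j` only
  -- permutes the factors, and the factor free of `j` appears `|G|` times.
  refine ⟨fun g => ∏ j, α.1 (g, j), fun g h => ?_⟩
  have key : (∏ j, α.1 (g * h, j)) * α.1 (g, h) ^ Fintype.card G =
      (g • ∏ j, α.1 (h, j)) * ∏ j, α.1 (g, j) := by
    rw [Finset.smul_prod', ← Fintype.prod_equiv (Equiv.mulLeft h) (fun j => α.1 (g, h * j))
      (fun j => α.1 (g, j)) (fun _ => rfl), ← Finset.card_univ, ← Finset.prod_const,
      ← Finset.prod_mul_distrib, ← Finset.prod_mul_distrib]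
    exact Finset.prod_congr rfl fun j _ => α.2 g h j
  rw [Nat.card_eq_fintype_card, Pi.pow_apply, div_mul_eq_mul_div, ← key, mul_div_cancel_left]

end Cohomology

/-! ### Adjoining roots inside a finite Galois extension. -/

section Extension

variable {k : Type u} {L : Type v} [Field k] [Field L] [Algebra k L]

/-- Finitely many elements of a finite Galois extension acquire `m`-th roots in a larger finite
Galois extension, when `m` is invertible. -/
theorem exists_isGalois_forall_exists_pow_eq [FiniteDimensional k L] [IsGalois k L]
    {ι : Type*} [Finite ι] (c : ι → L) (m : ℕ) (hm : (m : L) ≠ 0) :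
    ∃ (K : Type v) (_ : Field K) (_ : Algebra k K) (_ : Algebra L K) (_ : IsScalarTower k L K)
      (_ : FiniteDimensional k K) (_ : IsGalois k K),
      ∃ d : ι → K, ∀ i, d i ^ m = algebraMap L K (c i) := by
  let Ω := SeparableClosure L
  have : Algebra.IsSeparable k Ω := Algebra.IsSeparable.trans k L Ω
  have : IsSepClosure k Ω := ⟨inferInstance, inferInstance⟩
  have : IsGalois k Ω := inferInstance
  -- With `m` invertible, `X ^ m - c i` is separable for `c i ≠ 0`, so a separable closure is large
  -- enough to contain the roots.
  have : NeZero (m : Ω) := ⟨by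
    rw [← map_natCast (algebraMap L Ω)]
    exact (map_ne_zero _).2 hm⟩
  choose d hd using fun i => IsSepClosed.exists_pow_nat_eq (algebraMap L Ω (c i)) m
  let F := IntermediateField.adjoin L (Set.range d)
  have : FiniteDimensional L F :=
    IntermediateField.finiteDimensional_adjoin fun x _ => Algebra.IsIntegral.isIntegral x
  have : FiniteDimensional k F := FiniteDimensional.trans k L F
  have : IsScalarTower k F Ω := IsScalarTower.of_algebraMap_eq fun _ => rfl
  -- `F` need not be normal over `k`, since conjugates of the `c i` may have roots outside it.
  let K := IntermediateField.normalClosure k F Ω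
  let _ : Algebra L K := ((algebraMap F K).comp (algebraMap L F)).toAlgebra
  have : IsScalarTower k L K := IsScalarTower.of_algebraMap_eq fun _ => rfl
  refine ⟨K, inferInstance, inferInstance, inferInstance, this, inferInstance, inferInstance,
    fun i => algebraMap F K ⟨d i, IntermediateField.subset_adjoin _ _ ⟨i, rfl⟩⟩, fun i => ?_⟩
  exact Subtype.ext (hd i)

end Extension

/-! ### Crossed products under inflation. -/

/-- Matrices of size one over an algebra are the algebra itself. -/
def Matrix.finOneAlgEquiv (R : Type*) (A : Type*) [CommSemiring R] [Semiring A] [Algebra R A] :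
    Matrix (Fin 1) (Fin 1) A ≃ₐ[R] A where
  toFun M := M 0 0
  invFun a := Matrix.of fun _ _ => a
  left_inv M := by ext i j; rw [Subsingleton.elim i 0, Subsingleton.elim j 0]; rfl
  right_inv _ := rfl
  map_mul' M N := by simp [Matrix.mul_apply]
  map_add' _ _ := rfl
  commutes' r := by simp [Matrix.algebraMap_matrix_apply]

namespace CrossedProduct

variable {k : Type u} {L K : Type v} [Field k] [Field L] [Field K] [Algebra k L] [Algebra k K]
  [Algebra L K] [IsScalarTower k L K]

theorem of_sum (α : TwoCocycles Gal(L/k) Lˣ) {κ : Type*} (s : Finset κ) (g : Gal(L/k))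
    (f : κ → L) : of α g (∑ i ∈ s, f i) = ∑ i ∈ s, of α g (f i) :=
  map_sum (Finsupp.singleAddHom g) f s

theorem finrank_eq [FiniteDimensional k L] [IsGalois k L] (α : TwoCocycles Gal(L/k) Lˣ) :
    Module.finrank k (CrossedProduct α) = Module.finrank k L * Module.finrank k L := by
  have := Fintype.ofFinite Gal(L/k)
  refine (Module.finrank_finsupp k L (ι := Gal(L/k))).trans ?_
  rw [← Nat.card_eq_fintype_card, IsGalois.card_aut_eq_finrank]

section Matrix

variable [Normal k L]

/-- The inflation of a 2-cocycle of `Gal(L/k)` to `Gal(K/k)`. -/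
noncomputable def inflation (α : TwoCocycles Gal(L/k) Lˣ) : TwoCocycles Gal(K/k) Kˣ :=
  ⟨fun p => Units.map (algebraMap L K)
    (α.1 (AlgEquiv.restrictNormalHom L p.1, AlgEquiv.restrictNormalHom L p.2)), fun g h j => by
      have key := cocycle_apply α (AlgEquiv.restrictNormalHom L g) (AlgEquiv.restrictNormalHom L h)
        (AlgEquiv.restrictNormalHom L j)
      ext
      have := congrArg (algebraMap L K) key
      simp only [map_mul] at this ⊢
      refine this.trans ?_
      congr 1
      exact AlgEquiv.restrictNormal_commutes g L _⟩

theorem inflation_apply (α : TwoCocycles Gal(L/k) Lˣ) (σ τ : Gal(K/k)) :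
    (inflation α).1 (σ, τ) = Units.map (algebraMap L K)
      (α.1 (AlgEquiv.restrictNormalHom L σ, AlgEquiv.restrictNormalHom L τ)) := rfl

variable (α : TwoCocycles Gal(L/k) Lˣ) (β : TwoCocycles Gal(K/k) Kˣ) (e : Gal(K/k) → Kˣ)
  {ι : Type*} (b : Module.Basis ι L K)

/-- The matrix, with respect to a basis of `K / L`, by which `x U_σ` acts on the right module
`K ⊗[L] CrossedProduct α`, where `U_σ` acts as `y ⊗ a ↦ e σ * σ y ⊗ U_σ a`. -/
noncomputable def matrixOf (σ : Gal(K/k)) : K →ₗ[k] Matrix ι ι (CrossedProduct α) where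
  toFun x := Matrix.of fun i j =>
    of α (AlgEquiv.restrictNormalHom L σ) (b.repr (x * e σ * σ (b j)) i)
  map_add' x y := by
    ext1 i j
    simp only [Matrix.of_apply, Matrix.add_apply, ← of_add, add_mul, map_add, Finsupp.add_apply]
  map_smul' c x := by
    ext1 i j
    simp only [Matrix.of_apply, Matrix.smul_apply, smul_of, smul_mul_assoc, RingHom.id_apply]
    congr 1
    rw [← algebraMap_smul L c (x * e σ * σ (b j)), map_smul, Finsupp.smul_apply, algebraMap_smul]

theorem matrixOf_apply (σ : Gal(K/k)) (x : K) (i j : ι) :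
    matrixOf α e b σ x i j =
      of α (AlgEquiv.restrictNormalHom L σ) (b.repr (x * e σ * σ (b j)) i) := rfl

/-- The unit of the crossed product is `β(1, 1)⁻¹ U_1`. At `(1, 1)` the relation `he` reads `β(1, 1)
= e 1 * α(1, 1)`, so the scalar left on the diagonal is `α(1, 1)⁻¹`, the coefficient of the unit
there. -/
theorem matrixOf_one [DecidableEq ι]
    (he : ∀ σ τ, β.1 (σ, τ) * e (σ * τ) = e σ * σ • e τ * (inflation α).1 (σ, τ)) :
    matrixOf α e b 1 ((β.1 (1, 1))⁻¹ : Kˣ) = 1 := by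
  have h1 : (β.1 (1, 1))⁻¹ * e 1 = Units.map (algebraMap L K) (α.1 (1, 1))⁻¹ := by
    have := he 1 1
    rw [one_smul, mul_one, mul_right_comm, mul_left_inj, inflation_apply, map_one] at this
    rw [this, mul_inv, inv_mul_cancel_comm, map_inv]
  have h2 : (((β.1 (1, 1))⁻¹ : Kˣ) : K) * e 1 = algebraMap L K ((α.1 (1, 1))⁻¹ : Lˣ) :=
    congrArg Units.val h1
  ext1 i j
  rw [matrixOf_apply, h2, ← Algebra.smul_def, map_smul, AlgEquiv.one_apply, b.repr_self,
    Finsupp.smul_apply, Matrix.one_apply, one_def, map_one]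
  split_ifs with h
  · subst h; simp
  · rw [Finsupp.single_eq_of_ne h, smul_zero, of_zero]

variable [Fintype ι]

/-- The map `y ↦ x * σ y` is semilinear over the restriction of `σ` to `L`, so its matrix applies to
coordinates twisted by that restriction. The twist is exactly what moving scalars past `U_σ`
produces. -/
theorem sum_repr_mul_restrict (σ : Gal(K/k)) (x y : K) (i : ι) :
    ∑ j, b.repr (x * σ (b j)) i * AlgEquiv.restrictNormalHom L σ (b.repr y j) =
      b.repr (x * σ y) i := by
  conv_rhs => rw [← b.sum_repr y, map_sum, Finset.mul_sum, map_sum, Finsupp.finsetSum_apply]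
  refine Finset.sum_congr rfl fun j _ => ?_
  have h : σ (algebraMap L K (b.repr y j)) =
      algebraMap L K (AlgEquiv.restrictNormalHom L σ (b.repr y j)) :=
    (AlgEquiv.restrictNormal_commutes σ L _).symm
  rw [Algebra.smul_def, map_mul σ, h, mul_left_comm, ← Algebra.smul_def, map_smul,
    Finsupp.smul_apply, smul_eq_mul, mul_comm]

/-- Composing the two semilinear maps leaves the factor `e σ * σ (e τ)` together with the value of
`α`, and `he` trades these for `β (σ, τ) * e (σ * τ)`. -/
theorem matrixOf_mul_matrixOf
    (he : ∀ σ τ, β.1 (σ, τ) * e (σ * τ) = e σ * σ • e τ * (inflation α).1 (σ, τ))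
    (σ τ : Gal(K/k)) (x y : K) :
    matrixOf α e b σ x * matrixOf α e b τ y =
      matrixOf α e b (σ * τ) (x * σ y * (β.1 (σ, τ) : K)) := by
  have he' : (β.1 (σ, τ) : K) * e (σ * τ) = e σ * σ (e τ) * algebraMap L K
      (α.1 (AlgEquiv.restrictNormalHom L σ, AlgEquiv.restrictNormalHom L τ)) :=
    congrArg Units.val (he σ τ)
  ext1 i l
  simp only [Matrix.mul_apply, matrixOf_apply, of_mul_of, ← of_sum, ← Finset.sum_mul,
    sum_repr_mul_restrict, map_mul]
  congr 1
  rw [mul_assoc (x * σ y), he', AlgEquiv.mul_apply, mul_comm, ← smul_eq_mul, ← Finsupp.smul_apply,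
    ← map_smul, Algebra.smul_def]
  congr 2
  ring

/-- If `β` differs from the inflation of `α` by the coboundary of `e`, the crossed product of `β`
acts on `K ⊗[L] CrossedProduct α`, giving a homomorphism to matrices over `CrossedProduct α`. -/
noncomputable def toMatrix [DecidableEq ι]
    (he : ∀ σ τ, β.1 (σ, τ) * e (σ * τ) = e σ * σ • e τ * (inflation α).1 (σ, τ)) :
    CrossedProduct β →ₐ[k] Matrix ι ι (CrossedProduct α) :=
  let f : CrossedProduct β →ₗ[k] Matrix ι ι (CrossedProduct α) :=
    Finsupp.lsum (R := k) k (M := K) (matrixOf α e b)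
  have hf (σ : Gal(K/k)) (x : K) : f (of β σ x) = matrixOf α e b σ x :=
    Finsupp.lsum_single k (matrixOf α e b) σ x
  AlgHom.ofLinearMap f ((hf _ _).trans (matrixOf_one α β e b he)) fun x y => by
    induction x using induction_of β with
    | h0 => simp
    | hadd x x' hx hx' => simp only [add_mul, map_add, hx, hx']
    | hof σ x =>
      induction y using induction_of β with
      | h0 => simp
      | hadd y y' hy hy' => simp only [mul_add, map_add, hy, hy']
      | hof τ y => rw [of_mul_of, hf, hf, hf, matrixOf_mul_matrixOf α β e b he]

end Matrix

/-- Crossed products of 2-cocycles with cohomologous inflations are Brauer equivalent. -/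
theorem isBrauerEquivalent_csa_of_inflation [FiniteDimensional k L] [IsGalois k L]
    [FiniteDimensional k K] [IsGalois k K] (α : TwoCocycles Gal(L/k) Lˣ)
    (β : TwoCocycles Gal(K/k) Kˣ) (e : Gal(K/k) → Kˣ)
    (he : ∀ σ τ, β.1 (σ, τ) * e (σ * τ) = e σ * σ • e τ * (inflation α).1 (σ, τ)) :
    IsBrauerEquivalent (csa α) (csa β) := by
  have : FiniteDimensional L K := FiniteDimensional.right k L K
  have hr : Module.finrank L K ≠ 0 := Module.finrank_pos.ne'
  have : NeZero (Module.finrank L K) := ⟨hr⟩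
  let f := toMatrix α β e (Module.finBasis L K) he
  -- A ring homomorphism from a simple ring to a nontrivial ring is injective.
  have hinj : Function.Injective f := f.toRingHom.injective
  have hdim : Module.finrank k (CrossedProduct β) =
      Module.finrank k (Matrix (Fin (Module.finrank L K)) (Fin (Module.finrank L K))
        (CrossedProduct α)) := by
    rw [Module.finrank_matrix, finrank_eq, finrank_eq, Fintype.card_fin,
      ← Module.finrank_mul_finrank k L K]
    ring
  have hsurj : Function.Surjective f :=
    (LinearMap.injective_iff_surjective_of_finrank_eq_finrank hdim (f := f.toLinearMap)).1 hinj
  exact ⟨_, 1, hr, one_ne_zero,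
    ⟨(AlgEquiv.ofBijective f ⟨hinj, hsurj⟩).symm.trans (Matrix.finOneAlgEquiv k _).symm⟩⟩

end CrossedProduct

/-! ### Construction of the finite cocycle. -/

theorem mainTheorem5 {k : Type u} {L : Type v} [Field k] [Field L] [Algebra k L]
    [FiniteDimensional k L] [IsGalois k L]
    (α : TwoCocycles Gal(L/k) Lˣ) (m : ℕ) (hm : orderOf (cohomologyClass α) = m)
    (hchar : ringChar k = 0 ∨ ¬ ringChar k ∣ m) :
    ∃ (K : Type v) (_ : Field K) (_ : Algebra k K) (_ : Algebra L K) (_ : IsScalarTower k L K)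
      (_ : FiniteDimensional k K) (_ : IsGalois k K) (β : TwoCocycles Gal(K/k) Kˣ),
      IsFiniteCocycle β ∧ (∀ g h : Gal(K/k), β.1 (g, h) ^ m = 1) ∧
        IsBrauerEquivalent (CrossedProduct.csa α) (CrossedProduct.csa β) := by
  -- `orderOf` is `0` on elements of infinite order; this is excluded because `H²` is killed by
  -- `|G|`.
  have hm0 : m ≠ 0 := by
    rintro rfl
    exact orderOf_eq_zero_iff'.1 hm _ Nat.card_pos (TwoCocycles.cohomologyClass_pow_card α)
  have hmk : (m : k) ≠ 0 := fun h => by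
    have hdvd := (ringChar.spec k m).1 h
    rcases hchar with h0 | h0
    · rw [h0, zero_dvd_iff] at hdvd
      exact hm0 hdvd
    · exact h0 hdvd
  have hmL : (m : L) ≠ 0 := by
    rw [← map_natCast (algebraMap k L)]
    exact (map_ne_zero _).2 hmk
  obtain ⟨c, hc⟩ := (TwoCocycles.pow_cohomologyClass_eq_one_iff α m).1 (hm ▸ pow_orderOf_eq_one _)
  obtain ⟨K, _, _, _, _, _, _, d, hd⟩ :=
    exists_isGalois_forall_exists_pow_eq (k := k) (fun g => ((c g : Lˣ) : L)) m hmL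
  have hd0 (g : Gal(L/k)) : d g ≠ 0 := fun h => by
    have := hd g
    rw [h, zero_pow hm0] at this
    exact (map_ne_zero (algebraMap L K)).2 (c g).ne_zero this.symm
  -- The inverse makes the `m`-th power of the coboundary of `e` cancel the inflation of `α ^ m`,
  -- the coboundary of `c`.
  let e (σ : Gal(K/k)) : Kˣ := (Units.mk0 _ (hd0 (AlgEquiv.restrictNormalHom L σ)))⁻¹
  have hem (σ : Gal(K/k)) :
      e σ ^ m = (Units.map (algebraMap L K) (c (AlgEquiv.restrictNormalHom L σ)))⁻¹ := by
    rw [inv_pow, inv_inj]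
    ext
    exact hd _
  let δ : TwoCocycles Gal(K/k) Kˣ := ⟨fun p => p.1 • e p.2 / e (p.1 * p.2) * e p.1,
    groupCohomology.isMulCocycle₂_of_isMulCoboundary₂ (G := Gal(K/k)) (M := Kˣ)
      (f := fun p => p.1 • e p.2 / e (p.1 * p.2) * e p.1) ⟨e, fun _ _ => rfl⟩⟩
  let β := δ * CrossedProduct.inflation α
  have hβ (σ τ : Gal(K/k)) : β.1 (σ, τ) =
      σ • e τ / e (σ * τ) * e σ * (CrossedProduct.inflation α).1 (σ, τ) := rfl
  have hpow (σ τ : Gal(K/k)) : β.1 (σ, τ) ^ m = 1 := by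
    -- Needed because `e` itself is not `L`-valued: only its `m`-th power is, and there `σ` acts
    -- through its restriction.
    have hs (x : Lˣ) : σ • Units.map (algebraMap L K : L →* K) x =
        Units.map (algebraMap L K) (AlgEquiv.restrictNormalHom L σ • x) := by
      ext
      exact (AlgEquiv.restrictNormal_commutes σ L _).symm
    have hα := hc (AlgEquiv.restrictNormalHom L σ) (AlgEquiv.restrictNormalHom L τ)
    rw [Pi.pow_apply] at hα
    rw [hβ, mul_pow, mul_pow, div_pow, ← smul_pow', hem, hem, hem,
      CrossedProduct.inflation_apply, ← map_pow, smul_inv', hs,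
      ← hα, map_mul (AlgEquiv.restrictNormalHom L), map_mul, map_div, inv_div_inv, ← inv_div,
      ← mul_inv, inv_mul_cancel]
  refine ⟨K, inferInstance, inferInstance, inferInstance, inferInstance, inferInstance,
    inferInstance, β, fun g h => isOfFinOrder_iff_pow_eq_one.2 ⟨m, hm0.bot_lt, hpow g h⟩, hpow,
    CrossedProduct.isBrauerEquivalent_csa_of_inflation α β e fun σ τ => ?_⟩
  rw [hβ, mul_right_comm, mul_right_comm _ (e σ), div_mul_cancel, mul_comm (e σ)]
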